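/- Let $\Bbbk$ be a field and let $(V,c)$ be a finite-dimensional braided vector space, i.e. $c\in\mathrm{End}_\Bbbk(V\otimes V)$ is invertible and $c_{12}c_{23}c_{12}=c_{23}c_{12}c_{23}$ on $V^{\otimes 3}$. Fix a basis $(v_i)_{1\le i\le N}$ of $V$ and write $c(v_i\otimes v_j)=\sum_{k,\ell}c_{ij}^{k\ell}\,v_k\otimes v_\ell$. Let $A(c)$ be the FRT bialgebra: the quotient of the free algebra $\Bbbk\{T_i^j\}_{1\le i,j\le N}$ by the two-sided ideal generated by the elements $\sum_{m,n}(c_{ij}^{mn}T_m^kT_n^\ell-T_i^mT_j^nc_{mn}^{k\ell})$, with $\Delta(T_i^j)=\sum_sT_i^s\otimes T_s^j$ and $\varepsilon(T_i^j)=\delta_i^j$. Let $\mathcal R\colon A(c)\otimes A(c)\to\Bbbk$ be its coquasitriangular structure, determined by $\mathcal R(T_i^k\otimes T_j^\ell)=c_{ji}^{k\ell}$; that is, $\mathcal R$ is invertible for the convolution product $*$ and satisfies $\mathcal R*m=m^{\mathrm{op}}*\mathcal R$, $\mathcal R(\mathrm{Id}\otimes m)=\mathcal R_{13}*\mathcal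 R_{12}$ and $\mathcal R(m\otimes\mathrm{Id})=\mathcal R_{13}*\mathcal R_{23}$, where $m$ is the multiplication and scalar-valued maps are regarded as $A(c)$-valued through the unit where needed. Then there is a linear map $\partial\colon A(c)\to\Bbbk$ with $\partial(T_{i_1}^{j_1}\cdots T_{i_m}^{j_m})=m\,\varepsilon(T_{i_1}^{j_1}\cdots T_{i_m}^{j_m})$ for all monomials, and it is a derivation: $\partial(xy)=\partial(x)\varepsilon(y)+\varepsilon(x)\partial(y)$. For every $\lambda\in\Bbbk$, the linear map $\chi_\lambda:=\lambda\,\partial\otimes\partial\colon A(c)\otimes A(c)\to\Bbbk$ is given on monomials by $$\chi_\lambda(T_{i_1}^{j_1}\cdots T_{i_m}^{j_m}\otimes T_{k_1}^{\ell_1}\cdots T_{k_n}^{\ell_n})=\lambda\,mn\,\varepsilon(T_{i_1}^{j_1}\cdots T_{i_m}^{j_m}T_{k_1}^{\ell_1}\cdots T_{k_n}^{\ell_n}),$$ and it is an infinitesimal $\mathcal R$-form, i.e. $\chi=\chi_\lambda$ satisfies $$\chi*m=m*\chi,\qquad \chi(\mathrm{Id}\otimes m)=\chi_{12}+\mathcal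 R_{12}^{-1}*\chi_{13}*\mathcal R_{12},\qquad \chi(m\otimes\mathrm{Id})=\chi_{23}+\mathcal R_{23}^{-1}*\chi_{13}*\mathcal R_{23}.$$ Moreover $(A(c),\mathcal R,\chi_\lambda)$ is Cartier, i.e. in addition $\mathcal R*\chi_\lambda=\chi_\lambda^{\mathrm{op}}*\mathcal R$, where $\chi^{\mathrm{op}}=\chi\circ\tau$ with $\tau$ the flip. -/

import Mathlib

open TensorProduct WithConv

noncomputable section

/-! ### Convolution notions: coquasitriangular, pre-Cartier and Cartier bialgebras -/

namespace Cartier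

variable {k H : Type*} [Field k] [Ring H] [Bialgebra k H]

/-- `f₁₂ = f ⊗ ε` on `H ⊗ H ⊗ H`. -/
def leg12 (f : H ⊗[k] H →ₗ[k] k) : (H ⊗[k] H) ⊗[k] H →ₗ[k] k :=
  LinearMap.mul' k k ∘ₗ TensorProduct.map f (Coalgebra.counit (R := k) (A := H))

/-- `f₂₃ = ε ⊗ f` on `H ⊗ H ⊗ H`. -/
def leg23 (f : H ⊗[k] H →ₗ[k] k) : (H ⊗[k] H) ⊗[k] H →ₗ[k] k :=
  LinearMap.mul' k k ∘ₗ TensorProduct.map (Coalgebra.counit (R := k) (A := H)) f ∘ₗ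
    (TensorProduct.assoc k H H H).toLinearMap

/-- `f₁₃ = (ε ⊗ f) ∘ (τ ⊗ id)` on `H ⊗ H ⊗ H`. -/
def leg13 (f : H ⊗[k] H →ₗ[k] k) : (H ⊗[k] H) ⊗[k] H →ₗ[k] k :=
  leg23 f ∘ₗ LinearMap.rTensor H (TensorProduct.comm k H H).toLinearMap

/-- `f^op = f ∘ τ`. -/
def flip {M : Type*} [AddCommGroup M] [Module k M] (f : H ⊗[k] H →ₗ[k] M) : H ⊗[k] H →ₗ[k] M :=
  f ∘ₗ (TensorProduct.comm k H H).toLinearMap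

/-- `u_H ∘ f`, a scalar-valued map regarded as `H`-valued. -/
def unitComp (f : H ⊗[k] H →ₗ[k] k) : H ⊗[k] H →ₗ[k] H :=
  Algebra.linearMap k H ∘ₗ f

/-- `id ⊗ m` on `H ⊗ H ⊗ H`. -/
def idMul : (H ⊗[k] H) ⊗[k] H →ₗ[k] H ⊗[k] H :=
  LinearMap.lTensor H (LinearMap.mul' k H) ∘ₗ (TensorProduct.assoc k H H H).toLinearMap

/-- `m ⊗ id` on `H ⊗ H ⊗ H`. -/
def mulId : (H ⊗[k] H) ⊗[k] H →ₗ[k] H ⊗[k] H :=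
  LinearMap.rTensor H (LinearMap.mul' k H)

/-- The inverse of a linear form on `H ⊗ H` for the convolution product
(used only for convolution-invertible forms). -/
def convInv (f : H ⊗[k] H →ₗ[k] k) : H ⊗[k] H →ₗ[k] k :=
  (Ring.inverse (toConv f)).ofConv

/-- `R` is a universal `R`-form, i.e. `(H, R)` is a coquasitriangular bialgebra. All products
below are convolution products. -/
structure IsUniversalRForm (R : H ⊗[k] H →ₗ[k] k) : Prop where
  isUnit : IsUnit (toConv R)
  /-- `R * m = m^op * R` -/
  quasiComm : toConv (unitComp R) * toConv (LinearMap.mul' k H) =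
    toConv (flip (LinearMap.mul' k H)) * toConv (unitComp R)
  /-- `R (id ⊗ m) = R₁₃ * R₁₂` -/
  idMul_eq : toConv (R ∘ₗ idMul) = toConv (leg13 R) * toConv (leg12 R)
  /-- `R (m ⊗ id) = R₁₃ * R₂₃` -/
  mulId_eq : toConv (R ∘ₗ mulId) = toConv (leg13 R) * toConv (leg23 R)

/-- `χ` is an infinitesimal `R`-form for the coquasitriangular bialgebra `(H, R)`, i.e.
`(H, R, χ)` is a pre-Cartier coquasitriangular bialgebra. -/
structure IsInfinitesimalRForm (R χ : H ⊗[k] H →ₗ[k] k) : Prop where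
  isUniversalRForm : IsUniversalRForm R
  /-- `χ * m = m * χ` -/
  mul_comm : toConv (unitComp χ) * toConv (LinearMap.mul' k H) =
    toConv (LinearMap.mul' k H) * toConv (unitComp χ)
  /-- `χ (id ⊗ m) = χ₁₂ + R₁₂⁻¹ * χ₁₃ * R₁₂` -/
  idMul_eq : toConv (χ ∘ₗ idMul) =
    toConv (leg12 χ) + toConv (leg12 (convInv R)) * toConv (leg13 χ) * toConv (leg12 R)
  /-- `χ (m ⊗ id) = χ₂₃ + R₂₃⁻¹ * χ₁₃ * R₂₃` -/
  mulId_eq : toConv (χ ∘ₗ mulId) =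
    toConv (leg23 χ) + toConv (leg23 (convInv R)) * toConv (leg13 χ) * toConv (leg23 R)

/-- `(H, R, χ)` is a Cartier coquasitriangular bialgebra: it is pre-Cartier and
`R * χ = χ^op * R`. -/
structure IsCartier (R χ : H ⊗[k] H →ₗ[k] k) : Prop extends IsInfinitesimalRForm R χ where
  symm : toConv R * toConv χ = toConv (flip χ) * toConv R

end Cartier

/-! ### Braided vector spaces -/

section Braided

variable {k V : Type*} [Field k] [AddCommGroup V] [Module k V]

/-- `c₁₂ = c ⊗ id` on `V ⊗ V ⊗ V`. -/
def op12 (c : Module.End k (V ⊗[k] V)) : Module.End k ((V ⊗[k] V) ⊗[k] V) :=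
  LinearMap.rTensor V c

/-- `c₂₃ = id ⊗ c` on `V ⊗ V ⊗ V`. -/
def op23 (c : Module.End k (V ⊗[k] V)) : Module.End k ((V ⊗[k] V) ⊗[k] V) :=
  (TensorProduct.assoc k V V V).symm.toLinearMap ∘ₗ LinearMap.lTensor V c ∘ₗ
    (TensorProduct.assoc k V V V).toLinearMap

/-- `(V, c)` is a braided vector space: `c` is an invertible solution of the braid equation. -/
structure IsBraided (c : Module.End k (V ⊗[k] V)) : Prop where
  isUnit : IsUnit c
  braid : op12 c * op23 c * op12 c = op23 c * op12 c * op23 c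

variable {ι : Type*} [Fintype ι]

/-- The coefficients `c_{ij}^{pq}` of `c` in the basis `b`:
`c (b i ⊗ b j) = ∑ p q, c_{ij}^{pq} b p ⊗ b q`. -/
def braidCoeff (b : Module.Basis ι k V) (c : Module.End k (V ⊗[k] V)) (i j p q : ι) : k :=
  (b.tensorProduct b).repr (c (b i ⊗ₜ b j)) (p, q)

/-- The braid equation for a tensor of coefficients. -/
def CoeffBraid (γ : ι → ι → ι → ι → k) : Prop :=
  ∀ m n i j p l, ∑ x, ∑ y, ∑ s, γ m n x y * γ y i s l * γ x s j p =
    ∑ s, ∑ y, ∑ x, γ n i s y * γ m s j x * γ x y p l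


lemma apply_eq_sum_braidCoeff (b : Module.Basis ι k V) (c : Module.End k (V ⊗[k] V)) (i j : ι) :
    c (b i ⊗ₜ b j) = ∑ p, ∑ q, braidCoeff b c i j p q • (b p ⊗ₜ[k] b q) := by
  rw [← (b.tensorProduct b).sum_repr (c (b i ⊗ₜ b j)), Fintype.sum_prod_type]
  simp [braidCoeff]

open Classical in
lemma IsBraided.coeffBraid {c : Module.End k (V ⊗[k] V)} (h : IsBraided c)
    (b : Module.Basis ι k V) : CoeffBraid (braidCoeff b c) := by
  have h12 : ∀ i j l, op12 c ((b i ⊗ₜ b j) ⊗ₜ b l) =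
      ∑ p, ∑ q, braidCoeff b c i j p q • ((b p ⊗ₜ[k] b q) ⊗ₜ[k] b l) := by
    intro i j l
    simp [op12, apply_eq_sum_braidCoeff b c, sum_tmul, smul_tmul']
  have h23 : ∀ i j l, op23 c ((b l ⊗ₜ b i) ⊗ₜ b j) =
      ∑ p, ∑ q, braidCoeff b c i j p q • ((b l ⊗ₜ[k] b p) ⊗ₜ[k] b q) := by
    intro i j l
    simp [op23, apply_eq_sum_braidCoeff b c, tmul_sum]
  intro m n i j p l
  have := congrArg (fun f => ((b.tensorProduct b).tensorProduct b).repr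
    (f ((b m ⊗ₜ b n) ⊗ₜ b i)) ((j, p), l)) h.braid
  simp [h12, h23, Finsupp.single_apply] at this
  simpa only [Finset.mul_sum, mul_assoc] using this

end Braided

/-! ### The FRT bialgebra -/

section FRT

variable {k ι : Type*} [Field k] [Fintype ι]

/-- The defining relations of `A(c)` on the free algebra `k{T_i^j}`, where the pair `(i, j)`
stands for the generator `T_i^j`:
`∑ c_{ij}^{mn} T_m^p T_n^q = ∑ T_i^m T_j^n c_{mn}^{pq}`. -/
inductive FRTRel (γ : ι → ι → ι → ι → k) : FreeAlgebra k (ι × ι) → FreeAlgebra k (ι × ι) → Prop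
  | rel (i j p q : ι) : FRTRel γ
      (∑ m, ∑ n, γ i j m n • (FreeAlgebra.ι k (m, p) * FreeAlgebra.ι k (n, q)))
      (∑ m, ∑ n, γ m n p q • (FreeAlgebra.ι k (i, m) * FreeAlgebra.ι k (j, n)))

/-- The algebra `A(c)`, for the coefficients `γ i j p q = c_{ij}^{pq}`: the quotient of the free
algebra by the two-sided ideal generated by the relations `FRTRel`. -/
def FRTAlgebra (γ : ι → ι → ι → ι → k) : Type _ := RingQuot (FRTRel γ)

namespace FRTAlgebra

lemma sum_comm_four {M : Type*} [AddCommMonoid M] (f : ι → ι → ι → ι → M) :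
    ∑ m, ∑ n, ∑ s, ∑ r, f m n s r = ∑ s, ∑ r, ∑ m, ∑ n, f m n s r := by
  have := Finset.sum_comm (s := Finset.univ) (t := Finset.univ)
    (f := fun (x y : ι × ι) => f x.1 x.2 y.1 y.2)
  simpa only [Fintype.sum_prod_type] using this

variable (γ : ι → ι → ι → ι → k)

instance : Ring (FRTAlgebra γ) := inferInstanceAs (Ring (RingQuot (FRTRel γ)))

instance : Algebra k (FRTAlgebra γ) := inferInstanceAs (Algebra k (RingQuot (FRTRel γ)))

/-- The generator `T_i^j` of `A(c)`. -/
def T (i j : ι) : FRTAlgebra γ := RingQuot.mkAlgHom k (FRTRel γ) (FreeAlgebra.ι k (i, j))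

lemma T_rel (i j p q : ι) :
    ∑ m, ∑ n, γ i j m n • (T γ m p * T γ n q) = ∑ m, ∑ n, γ m n p q • (T γ i m * T γ j n) := by
  have := RingQuot.mkAlgHom_rel k (FRTRel.rel (γ := γ) i j p q)
  simp only [map_sum, map_smul, map_mul] at this
  exact this

variable {γ} in
/-- Algebra maps out of `A(c)` are given by matrices satisfying the defining relations. -/
def lift {B : Type*} [Ring B] [Algebra k B] (t : ι → ι → B)
    (ht : ∀ i j p q, ∑ m, ∑ n, γ i j m n • (t m p * t n q) =
      ∑ m, ∑ n, γ m n p q • (t i m * t j n)) : FRTAlgebra γ →ₐ[k] B :=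
  RingQuot.liftAlgHom k ⟨FreeAlgebra.lift k fun x => t x.1 x.2, by
    rintro _ _ ⟨i, j, p, q⟩
    simpa only [map_sum, map_smul, map_mul, FreeAlgebra.lift_ι_apply] using ht i j p q⟩

variable {γ} in
@[simp]
lemma lift_T {B : Type*} [Ring B] [Algebra k B] (t : ι → ι → B)
    (ht : ∀ i j p q, ∑ m, ∑ n, γ i j m n • (t m p * t n q) =
      ∑ m, ∑ n, γ m n p q • (t i m * t j n)) (i j : ι) : lift t ht (T γ i j) = t i j := by
  unfold lift T
  erw [RingQuot.liftAlgHom_mkAlgHom_apply]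
  simp

variable {γ} in
lemma algHom_ext {B : Type*} [Ring B] [Algebra k B] {f g : FRTAlgebra γ →ₐ[k] B}
    (h : ∀ i j, f (T γ i j) = g (T γ i j)) : f = g := by
  apply RingQuot.ringQuot_ext' (S := k) (s := FRTRel γ)
  apply FreeAlgebra.hom_ext
  funext x
  exact h x.1 x.2

variable {γ} in
lemma induction_on {P : FRTAlgebra γ → Prop} (x : FRTAlgebra γ)
    (hr : ∀ r : k, P (algebraMap k _ r)) (hT : ∀ i j, P (T γ i j))
    (hmul : ∀ x y, P x → P y → P (x * y)) (hadd : ∀ x y, P x → P y → P (x + y)) : P x := by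
  obtain ⟨a, rfl⟩ := RingQuot.mkAlgHom_surjective k (FRTRel γ) x
  induction a using FreeAlgebra.induction with
  | grade0 r => rw [AlgHom.commutes]; exact hr r
  | grade1 x => exact hT x.1 x.2
  | mul a b ha hb => rw [map_mul]; exact hmul _ _ ha hb
  | add a b ha hb => rw [map_add]; exact hadd _ _ ha hb

/-- The coproduct, `Δ(T_i^j) = ∑ T_i^s ⊗ T_s^j`. -/
def comulHom : FRTAlgebra γ →ₐ[k] FRTAlgebra γ ⊗[k] FRTAlgebra γ :=
  lift (fun i j => ∑ s, T γ i s ⊗ₜ[k] T γ s j) (by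
    intro i j p q
    have e1 : ∀ m p n q, (∑ s, T γ m s ⊗ₜ[k] T γ s p) * (∑ s, T γ n s ⊗ₜ[k] T γ s q) =
        ∑ s, ∑ r, (T γ m s * T γ n r) ⊗ₜ[k] (T γ s p * T γ r q) := by
      intro m p n q
      simp [Finset.sum_mul_sum]
    simp only [e1, Finset.smul_sum, smul_tmul']
    have l : ∑ s, ∑ r, (∑ m, ∑ n, γ i j m n • (T γ m s * T γ n r)) ⊗ₜ[k] (T γ s p * T γ r q) =
        ∑ s, ∑ r, (T γ i s * T γ j r) ⊗ₜ[k] (∑ m, ∑ n, γ s r m n • (T γ m p * T γ n q)) := by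
      simp only [T_rel γ i j, sum_tmul, tmul_sum, smul_tmul]
      exact sum_comm_four _
    simp only [T_rel γ _ _ p q] at l
    simp only [sum_tmul, tmul_sum, tmul_smul, smul_tmul'] at l
    rw [sum_comm_four, l, sum_comm_four])

variable [DecidableEq ι]

/-- The counit, `ε(T_i^j) = δ_i^j`. -/
def counitHom : FRTAlgebra γ →ₐ[k] k :=
  lift (fun i j => if i = j then 1 else 0) (by intro i j p q; simp)

instance : Bialgebra k (FRTAlgebra γ) :=
  Bialgebra.ofAlgHom (comulHom γ) (counitHom γ)
    (by
      apply algHom_ext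
      intro i j
      simp [comulHom, sum_tmul, tmul_sum]
      exact Finset.sum_comm)
    (by
      apply algHom_ext
      intro i j
      simp [comulHom, counitHom, ite_tmul])
    (by
      apply algHom_ext
      intro i j
      simp [comulHom, counitHom, tmul_ite])

lemma comul_T (i j : ι) :
    Coalgebra.comul (R := k) (T γ i j) = ∑ s, T γ i s ⊗ₜ[k] T γ s j := lift_T _ _ i j

lemma counit_T (i j : ι) :
    Coalgebra.counit (R := k) (T γ i j) = if i = j then 1 else 0 := lift_T _ _ i j

/-- The monomial `T_{i₁}^{j₁} ⋯ T_{i_m}^{j_m}` for the word `(i₁, j₁), …, (i_m, j_m)`. -/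
def monomial (w : List (ι × ι)) : FRTAlgebra γ := (w.map fun x => T γ x.1 x.2).prod

/-- The algebra map `x ↦ ε(x) + ∂(x) ϵ` into the dual numbers, given by
`T_i^j ↦ δ_i^j (1 + ϵ)`. -/
def dualHom : FRTAlgebra γ →ₐ[k] DualNumber k :=
  lift (fun i j => if i = j then 1 + DualNumber.eps else 0) (by intro i j p q; simp)

/-- The derivation `∂ : A(c) → k` with `∂(x) = |x| ε(x)` for homogeneous `x` of degree `|x|`. -/
def degDeriv : FRTAlgebra γ →ₗ[k] k := TrivSqZeroExt.sndHom k k ∘ₗ (dualHom γ).toLinearMap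

/-- The algebra map `x ↦ (R(T_i^p ⊗ x))_{i,p}` to the opposite matrix algebra, determined by
`R(T_i^p ⊗ T_j^q) = c_{ji}^{pq}`. -/
def rMatrix (hγ : CoeffBraid γ) : FRTAlgebra γ →ₐ[k] (Matrix ι ι k)ᵐᵒᵖ :=
  lift (fun j q => MulOpposite.op (Matrix.of fun i p => γ j i p q)) (by
    intro m n p l
    apply MulOpposite.unop_injective
    ext i j
    have h := hγ m n i j p l
    simp only [mul_assoc] at h
    simp [Matrix.sum_apply, Matrix.mul_apply]
    simp only [Finset.mul_sum]
    rw [h]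
    refine (Finset.sum_comm.trans (Finset.sum_congr rfl fun y _ => Finset.sum_comm)).trans
      (Finset.sum_comm.trans ?_)
    refine Finset.sum_congr rfl fun x _ => Finset.sum_congr rfl fun y _ =>
      Finset.sum_congr rfl fun s _ => by ring)

/-- The linear form `x ↦ R(T_i^p ⊗ x)` on `A(c)`. -/
def rRow (hγ : CoeffBraid γ) (i p : ι) : FRTAlgebra γ →ₗ[k] k :=
  Matrix.entryLinearMap k k i p ∘ₗ (MulOpposite.opLinearEquiv k).symm.toLinearMap ∘ₗ
    (rMatrix γ hγ).toLinearMap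

lemma rRow_T (hγ : CoeffBraid γ) (i p j q : ι) : rRow γ hγ i p (T γ j q) = γ j i p q := by
  simp [rRow, rMatrix]

lemma rRow_one (hγ : CoeffBraid γ) (i p : ι) :
    rRow γ hγ i p 1 = if i = p then 1 else 0 := by
  simp [rRow, Matrix.one_apply]

lemma rRow_mul (hγ : CoeffBraid γ) (i p : ι) (x y : FRTAlgebra γ) :
    rRow γ hγ i p (x * y) = ∑ s, rRow γ hγ i s y * rRow γ hγ s p x := by
  simp [rRow, Matrix.mul_apply]

lemma rRow_tensor_mul (hγ : CoeffBraid γ) (i j p q : ι) (z w : FRTAlgebra γ ⊗[k] FRTAlgebra γ) :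
    LinearMap.mul' k k (TensorProduct.map (rRow γ hγ i p) (rRow γ hγ j q) (z * w)) =
      ∑ s, ∑ t, LinearMap.mul' k k (TensorProduct.map (rRow γ hγ i s) (rRow γ hγ j t) w) *
        LinearMap.mul' k k (TensorProduct.map (rRow γ hγ s p) (rRow γ hγ t q) z) := by
  induction z using TensorProduct.induction_on with
  | zero => simp
  | add z z' hz hz' => simp only [add_mul, map_add, hz, hz', mul_add, Finset.sum_add_distrib]
  | tmul a b =>
    induction w using TensorProduct.induction_on with
    | zero => simp
    | add w w' hw hw' => simp only [add_mul, map_add, hw, hw', mul_add, Finset.sum_add_distrib]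
    | tmul a' b' =>
      simp only [Algebra.TensorProduct.tmul_mul_tmul, TensorProduct.map_tmul,
        LinearMap.mul'_apply, rRow_mul, Finset.sum_mul_sum]
      refine Finset.sum_congr rfl fun x _ => Finset.sum_congr rfl fun y _ => by ring

lemma rRow_rel (hγ : CoeffBraid γ) (i j p q : ι) :
    ∑ m, ∑ n, γ i j m n • (toConv (rRow γ hγ m p) * toConv (rRow γ hγ n q)) =
      ∑ m, ∑ n, γ m n p q • (toConv (rRow γ hγ i m) * toConv (rRow γ hγ j n)) := by
  ext x
  simp only [WithConv.ofConv_sum, WithConv.ofConv_smul, LinearMap.sum_apply, LinearMap.smul_apply,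
    LinearMap.convMul_def, LinearMap.comp_apply, smul_eq_mul]
  induction x using induction_on generalizing i j p q with
  | hr r =>
    simp [Algebra.algebraMap_eq_smul_one, Algebra.TensorProduct.one_def, rRow_one, mul_comm]
  | hT u v =>
    have h := hγ u i j p q v
    simp [comul_T, rRow_T, Finset.mul_sum]
    simp only [mul_assoc] at h
    refine h.symm.trans ?_
    refine Finset.sum_congr rfl fun x _ => Finset.sum_comm.trans ?_
    refine Finset.sum_congr rfl fun y _ => Finset.sum_congr rfl fun s _ => by ring
  | hadd x y hx hy => simp only [map_add, mul_add, Finset.sum_add_distrib, hx, hy]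
  | hmul x y hx hy =>
    simp only [Bialgebra.comul_mul, rRow_tensor_mul, Finset.mul_sum]
    generalize hX : Coalgebra.comul (R := k) x = X at hx ⊢
    generalize hY : Coalgebra.comul (R := k) y = Y at hy ⊢
    set D : FRTAlgebra γ ⊗[k] FRTAlgebra γ → ι → ι → ι → ι → k := fun z i j p q =>
      LinearMap.mul' k k (TensorProduct.map (rRow γ hγ i p) (rRow γ hγ j q) z) with hD
    have hx' : ∀ i j p q, ∑ m, ∑ n, γ i j m n * D X m n p q = ∑ m, ∑ n, γ m n p q * D X i j m n :=
      hx
    have hy' : ∀ i j p q, ∑ m, ∑ n, γ i j m n * D Y m n p q = ∑ m, ∑ n, γ m n p q * D Y i j m n :=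
      hy
    change ∑ m, ∑ n, ∑ s, ∑ t, γ i j m n * (D Y m n s t * D X s t p q) =
      ∑ m, ∑ n, ∑ s, ∑ t, γ m n p q * (D Y i j s t * D X s t m n)
    calc _ = ∑ s, ∑ t, (∑ m, ∑ n, γ i j m n * D Y m n s t) * D X s t p q := by
          rw [sum_comm_four]
          simp only [Finset.sum_mul, mul_assoc]
      _ = ∑ m, ∑ n, D Y i j m n * (∑ s, ∑ t, γ m n s t * D X s t p q) := by
          simp only [hy', Finset.sum_mul, Finset.mul_sum]
          rw [sum_comm_four]
          refine Finset.sum_congr rfl fun m _ => Finset.sum_congr rfl fun n _ =>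
            Finset.sum_congr rfl fun s _ => Finset.sum_congr rfl fun t _ => by ring
      _ = _ := by
          simp only [hx', Finset.mul_sum]
          rw [sum_comm_four]
          refine Finset.sum_congr rfl fun m _ => Finset.sum_congr rfl fun n _ =>
            Finset.sum_congr rfl fun s _ => Finset.sum_congr rfl fun t _ => by ring

/-- The algebra map `x ↦ R(x ⊗ -)` into the convolution algebra of linear forms. -/
def rHom (hγ : CoeffBraid γ) : FRTAlgebra γ →ₐ[k] WithConv (FRTAlgebra γ →ₗ[k] k) :=
  lift (fun i p => toConv (rRow γ hγ i p)) (rRow_rel γ hγ)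

/-- The coquasitriangular structure `R` of `A(c)`: the bialgebra bicharacter with
`R(T_i^p ⊗ T_j^q) = c_{ji}^{pq}`. -/
def rForm (hγ : CoeffBraid γ) : FRTAlgebra γ ⊗[k] FRTAlgebra γ →ₗ[k] k :=
  TensorProduct.lift ((WithConv.linearEquiv k (FRTAlgebra γ →ₗ[k] k)).toLinearMap ∘ₗ
    (rHom γ hγ).toLinearMap)

end FRTAlgebra

end FRT

/-! ### The FRT bialgebra of a braided vector space -/

section

variable {k V ι : Type*} [Field k] [AddCommGroup V] [Module k V] [Fintype ι]

/-- The FRT bialgebra `A(c)`, in the basis `b` of `V`. -/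
abbrev FRT (b : Module.Basis ι k V) (c : Module.End k (V ⊗[k] V)) : Type _ :=
  FRTAlgebra (braidCoeff b c)

namespace FRT

variable [DecidableEq ι] (b : Module.Basis ι k V) (c : Module.End k (V ⊗[k] V))

/-- The counit of `A(c)`. -/
abbrev counit : FRT b c →ₗ[k] k := Coalgebra.counit

/-- The generator `T_i^j` of `A(c)`. -/
abbrev T (i j : ι) : FRT b c := FRTAlgebra.T (braidCoeff b c) i j

/-- The monomial `T_{i₁}^{j₁} ⋯ T_{i_m}^{j_m}` of `A(c)`. -/
abbrev monomial (w : List (ι × ι)) : FRT b c := FRTAlgebra.monomial (braidCoeff b c) w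

/-- The derivation `∂` of `A(c)`. -/
abbrev degDeriv : FRT b c →ₗ[k] k := FRTAlgebra.degDeriv (braidCoeff b c)

/-- The coquasitriangular structure `R` of `A(c)`. -/
abbrev rForm {c : Module.End k (V ⊗[k] V)} (hc : IsBraided c) : FRT b c ⊗[k] FRT b c →ₗ[k] k :=
  FRTAlgebra.rForm (braidCoeff b c) (hc.coeffBraid b)

end FRT

end

end

open TensorProduct WithConv

noncomputable section

namespace Cartier

open Coalgebra

/-! ### Bicharacters, and convolution identities inherited by products. -/

section Bialgebra

variable {k H : Type*} [Field k] [Ring H] [Bialgebra k H]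

/-! The infinitesimal part rests on one observation: a form `φ` with `φ(x₁) x₂ = x₁ φ(x₂)` commutes,
for convolution, with every linear map into an algebra (`IsCocentral.convMul_comm`). Cocentrality
passes to tensor products, so if `d` is a cocentral `ε`-derivation, then `χ = t d ⊗ d` and `χ₁₃` are
central. The conjugations by `R` in the axioms then disappear, what is left is the Leibniz rule for
`d` in each argument, and the Cartier identity holds because `χ` is symmetric
(`isCartier_smul_map`). The derivation `∂` is the `ϵ`-part of an algebra map to the dual numbers. It
is cocentral because `x ↦ ∂(x₁) x₂` and `x ↦ x₁ ∂(x₂)` are derivations of `A(c)` that both fix each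
generator.

The longer part is that `R` is a universal `R`-form. It is multiplicative in the first argument by
construction, and in the second by induction on the first, so it is a bicharacter. Each remaining
identity is then compatible with products in both arguments and need only be checked on generators.
There, quasi-commutativity is exactly the FRT relation (`formMatrix_exchange`, `formConst_mul_id`).

For invertibility, `c` and `c⁻¹` impose the same relations, so the bicharacter of `A(c⁻¹)` pulls
back to `A(c)`. Its flip is the convolution inverse of `R`, since on generators this says that the
two coefficient tensors are inverse (`convMul_flip_eq_one`, `isUnit_rForm`). -/

lemma convMul_tmul {B : Type*} [Ring B] [Algebra k B] {C D : Type*} [AddCommGroup C] [Module k C]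
    [Coalgebra k C] [AddCommGroup D] [Module k D] [Coalgebra k D]
    {α β : Type*} {x : C} {y : D} (rx : Repr k x α) (ry : Repr k y β)
    (f g : WithConv (C ⊗[k] D →ₗ[k] B)) :
    (f * g) (x ⊗ₜ y) = ∑ i ∈ rx.index, ∑ j ∈ ry.index,
      f (rx.left i ⊗ₜ ry.left j) * g (rx.right i ⊗ₜ ry.right j) := by
  rw [LinearMap.convMul_apply, TensorProduct.comul_tmul, ← rx.eq, ← ry.eq]
  simp [sum_tmul, tmul_sum]
  rw [Finset.sum_comm]

lemma map_mul_counit_right {M : Type*} [AddCommGroup M] [Module k M] {α : Type*} {x : H}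
    (rx : Repr k x α) (f : H →ₗ[k] M) :
    ∑ i ∈ rx.index, counit (R := k) (rx.right i) • f (rx.left i) = f x := by
  have := congrArg (fun z => f (TensorProduct.rid k H z)) (sum_tmul_counit_eq rx)
  simpa only [map_sum, rid_tmul, map_smul, one_smul] using this

lemma map_mul_counit_left {M : Type*} [AddCommGroup M] [Module k M] {α : Type*} {x : H}
    (rx : Repr k x α) (f : H →ₗ[k] M) :
    ∑ i ∈ rx.index, counit (R := k) (rx.left i) • f (rx.right i) = f x := by
  have := congrArg (fun z => f (TensorProduct.lid k H z)) (sum_counit_tmul_eq rx)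
  simpa only [map_sum, lid_tmul, map_smul, one_smul] using this

/-- The convolution element `R(x ⊗ -)`. -/
def leftForm (R : H ⊗[k] H →ₗ[k] k) : H →ₗ[k] WithConv (H →ₗ[k] k) :=
  (WithConv.linearEquiv k (H →ₗ[k] k)).symm.toLinearMap ∘ₗ TensorProduct.curry R

/-- The convolution element `R(- ⊗ y)`. -/
def rightForm (R : H ⊗[k] H →ₗ[k] k) : H →ₗ[k] WithConv (H →ₗ[k] k) := leftForm (flip R)

@[simp] lemma leftForm_apply (R : H ⊗[k] H →ₗ[k] k) (x y : H) : leftForm R x y = R (x ⊗ₜ y) := rfl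

@[simp] lemma rightForm_apply (R : H ⊗[k] H →ₗ[k] k) (x y : H) :
    rightForm R x y = R (y ⊗ₜ x) := rfl

/-- A bialgebra bicharacter: `R(xy ⊗ z) = R(x ⊗ z₁) R(y ⊗ z₂)` and
`R(x ⊗ yz) = R(x₁ ⊗ z) R(x₂ ⊗ y)`, together with the unit conditions. -/
structure IsBicharacter (R : H ⊗[k] H →ₗ[k] k) : Prop where
  one_left : leftForm R 1 = 1
  one_right : rightForm R 1 = 1
  mul_left : ∀ x y, leftForm R (x * y) = leftForm R x * leftForm R y
  mul_right : ∀ x y, rightForm R (x * y) = rightForm R y * rightForm R x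

/-- Currying turns convolution on `H ⊗ H` into convolution of maps from `H` to the convolution
algebra of `H`. Identities of forms can thus be proved by induction on one argument at a time. -/
lemma leftForm_convMul (f g : WithConv (H ⊗[k] H →ₗ[k] k)) (x : H) :
    leftForm (f * g).ofConv x = (toConv (leftForm f.ofConv) * toConv (leftForm g.ofConv)) x := by
  ext y
  rw [leftForm_apply, (ℛ k x).convMul_apply, convMul_tmul (ℛ k x) (ℛ k y)]
  simp [(ℛ k y).convMul_apply, -LinearMap.convMul_apply]

lemma flip_convMul (f g : WithConv (H ⊗[k] H →ₗ[k] k)) :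
    toConv (flip (f * g).ofConv) = toConv (flip f.ofConv) * toConv (flip g.ofConv) := by
  apply WithConv.ofConv_injective
  ext x y
  simp only [AlgebraTensorModule.curry_apply, curry_apply, LinearMap.restrictScalars_self]
  rw [convMul_tmul (ℛ k x) (ℛ k y)]
  simp only [flip, LinearMap.comp_apply, LinearEquiv.coe_coe, comm_tmul]
  rw [convMul_tmul (ℛ k y) (ℛ k x), Finset.sum_comm]

lemma flip_convOne : toConv (flip (1 : WithConv (H ⊗[k] H →ₗ[k] k)).ofConv) = 1 := by
  apply WithConv.ofConv_injective
  ext x y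
  simp [flip, mul_comm]

lemma mul_algebraMap_mul {B : Type*} [Ring B] [Algebra k B] (r : k) (a b : B) :
    a * algebraMap k B r * b = a * b * algebraMap k B r := by
  rw [mul_assoc, Algebra.commutes, mul_assoc]

/-- In `f(x₁) f(y₁) g(y₂) g(x₂)` the inner pair collapses to the scalar `ε(y)`, after which the
outer pair collapses to `ε(x)`. -/
lemma convMul_mul_eq_of_hom_antihom {B : Type*} [Ring B] [Algebra k B] {f g : H →ₗ[k] B}
    (hf : ∀ x y, f (x * y) = f x * f y) (hg : ∀ x y, g (x * y) = g y * g x) {x y : H}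
    (hx : (toConv f * toConv g) x = algebraMap k B (counit x))
    (hy : (toConv f * toConv g) y = algebraMap k B (counit y)) :
    (toConv f * toConv g) (x * y) = algebraMap k B (counit (x * y)) := by
  rw [(ℛ k x).convMul_apply] at hx
  rw [(ℛ k y).convMul_apply] at hy
  rw [((ℛ k x).mul (ℛ k y)).convMul_apply]
  have : ∀ i j, f ((ℛ k x).left i * (ℛ k y).left j) * g ((ℛ k x).right i * (ℛ k y).right j) =
      f ((ℛ k x).left i) * (f ((ℛ k y).left j) * g ((ℛ k y).right j)) * g ((ℛ k x).right i) := by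
    intro i j; rw [hf, hg]; noncomm_ring
  change ∑ i ∈ (ℛ k x).index ×ˢ (ℛ k y).index, f ((ℛ k x).left i.1 * (ℛ k y).left i.2) *
    g ((ℛ k x).right i.1 * (ℛ k y).right i.2) = _
  simp only [this, Finset.sum_product, ← Finset.sum_mul, ← Finset.mul_sum]
  simp only [hy, mul_algebraMap_mul, ← Finset.sum_mul, hx, Bialgebra.counit_mul, map_mul]

/-- Here the expansion is `f(y₁) f(x₁) g(x₂) g(y₂)`, so the `x`-pair collapses first. -/
lemma convMul_mul_eq_of_antihom_hom {B : Type*} [Ring B] [Algebra k B] {f g : H →ₗ[k] B}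
    (hf : ∀ x y, f (x * y) = f y * f x) (hg : ∀ x y, g (x * y) = g x * g y) {x y : H}
    (hx : (toConv f * toConv g) x = algebraMap k B (counit x))
    (hy : (toConv f * toConv g) y = algebraMap k B (counit y)) :
    (toConv f * toConv g) (x * y) = algebraMap k B (counit (x * y)) := by
  rw [(ℛ k x).convMul_apply] at hx
  rw [(ℛ k y).convMul_apply] at hy
  rw [((ℛ k x).mul (ℛ k y)).convMul_apply]
  have : ∀ i j, f ((ℛ k x).left i * (ℛ k y).left j) * g ((ℛ k x).right i * (ℛ k y).right j) =
      f ((ℛ k y).left j) * (f ((ℛ k x).left i) * g ((ℛ k x).right i)) * g ((ℛ k y).right j) := by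
    intro i j; rw [hf, hg]; noncomm_ring
  change ∑ i ∈ (ℛ k x).index ×ˢ (ℛ k y).index, f ((ℛ k x).left i.1 * (ℛ k y).left i.2) *
    g ((ℛ k x).right i.1 * (ℛ k y).right i.2) = _
  simp only [this, Finset.sum_product_right, ← Finset.sum_mul, ← Finset.mul_sum]
  simp only [hx, mul_algebraMap_mul, ← Finset.sum_mul, hy, Bialgebra.counit_mul, map_mul]
  exact (Algebra.commutes _ _).symm

/-- The product step for quasi-commutativity: `f(y₁) [f(x₁) t g(x₂)] g(y₂)` becomes `f(y₁) [g(x₁) t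
f(x₂)] g(y₂)`, which by commutation is `g(x₁) [f(y₁) t g(y₂)] f(x₂)`; the hypothesis at `y` then
applies to the new inner bracket. -/
lemma convMul_mul_exchange {B : Type*} [Ring B] [Algebra k B] {f g : H →ₗ[k] B} (t : B)
    (hf : ∀ x y, f (x * y) = f y * f x) (hg : ∀ x y, g (x * y) = g x * g y)
    (hfg : ∀ x y, Commute (f x) (g y)) {x y : H}
    (hx : (toConv f * toConv (LinearMap.mulLeft k t ∘ₗ g)) x =
      (toConv g * toConv (LinearMap.mulLeft k t ∘ₗ f)) x)
    (hy : (toConv f * toConv (LinearMap.mulLeft k t ∘ₗ g)) y =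
      (toConv g * toConv (LinearMap.mulLeft k t ∘ₗ f)) y) :
    (toConv f * toConv (LinearMap.mulLeft k t ∘ₗ g)) (x * y) =
      (toConv g * toConv (LinearMap.mulLeft k t ∘ₗ f)) (x * y) := by
  rw [(ℛ k x).convMul_apply, (ℛ k x).convMul_apply] at hx
  rw [(ℛ k y).convMul_apply, (ℛ k y).convMul_apply] at hy
  rw [((ℛ k x).mul (ℛ k y)).convMul_apply, ((ℛ k x).mul (ℛ k y)).convMul_apply]
  simp only [LinearMap.comp_apply, LinearMap.mulLeft_apply] at hx hy ⊢
  have e1 : ∀ i j, f ((ℛ k x).left i * (ℛ k y).left j) *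
        (t * g ((ℛ k x).right i * (ℛ k y).right j)) =
      f ((ℛ k y).left j) * (f ((ℛ k x).left i) * (t * g ((ℛ k x).right i))) *
        g ((ℛ k y).right j) := by
    intro i j; rw [hf, hg]; noncomm_ring
  have e2 : ∀ i j, f ((ℛ k y).left j) * (g ((ℛ k x).left i) * (t * f ((ℛ k x).right i))) *
        g ((ℛ k y).right j) =
      g ((ℛ k x).left i) * (f ((ℛ k y).left j) * (t * g ((ℛ k y).right j))) *
        f ((ℛ k x).right i) := by
    intro i j
    calc _ = (f ((ℛ k y).left j) * g ((ℛ k x).left i)) * t *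
          (f ((ℛ k x).right i) * g ((ℛ k y).right j)) := by noncomm_ring
      _ = _ := by rw [(hfg _ _).eq, (hfg _ _).eq]; noncomm_ring
  have e3 : ∀ i j, g ((ℛ k x).left i * (ℛ k y).left j) *
        (t * f ((ℛ k x).right i * (ℛ k y).right j)) =
      g ((ℛ k x).left i) * (g ((ℛ k y).left j) * (t * f ((ℛ k y).right j))) *
        f ((ℛ k x).right i) := by
    intro i j; rw [hf, hg]; noncomm_ring
  change ∑ i ∈ (ℛ k x).index ×ˢ (ℛ k y).index, f ((ℛ k x).left i.1 * (ℛ k y).left i.2) *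
      (t * g ((ℛ k x).right i.1 * (ℛ k y).right i.2)) =
    ∑ i ∈ (ℛ k x).index ×ˢ (ℛ k y).index, g ((ℛ k x).left i.1 * (ℛ k y).left i.2) *
      (t * f ((ℛ k x).right i.1 * (ℛ k y).right i.2))
  simp only [e1, e3]
  rw [Finset.sum_product_right, Finset.sum_product]
  simp only [← Finset.sum_mul, ← Finset.mul_sum, hx, ← hy]
  simp only [Finset.sum_mul, Finset.mul_sum, e2]
  exact Finset.sum_comm

/-! ### Convolution with values in the bialgebra -/

/-- The convolution element `y ↦ ε(y) a`. -/
def constConv : H →ₐ[k] WithConv (H →ₗ[k] H) :=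
  AlgHom.ofLinearMap
    ((WithConv.linearEquiv k (H →ₗ[k] H)).symm.toLinearMap ∘ₗ
      LinearMap.smulRightₗ (counit (R := k) (A := H)))
    (by ext y; simp [Algebra.algebraMap_eq_smul_one])
    (by
      intro a b
      ext y
      rw [(ℛ k y).convMul_apply]
      simp [smul_smul]
      rw [← Finset.sum_smul]
      congr 1
      simpa [mul_comm] using (map_mul_counit_left (ℛ k y) (counit (R := k) (A := H))).symm)

@[simp] lemma constConv_apply (a y : H) : constConv (k := k) a y = counit (R := k) y • a := rfl

lemma constConv_mul_id (a y : H) :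
    (constConv (k := k) a * toConv LinearMap.id : WithConv (H →ₗ[k] H)) y = a * y := by
  rw [(ℛ k y).convMul_apply]
  simpa using map_mul_counit_left (ℛ k y) (LinearMap.mulLeft k a)

lemma id_mul_constConv (a y : H) :
    (toConv LinearMap.id * constConv (k := k) a : WithConv (H →ₗ[k] H)) y = y * a := by
  rw [(ℛ k y).convMul_apply]
  simpa using map_mul_counit_right (ℛ k y) (LinearMap.mulRight k a)

variable {R : H ⊗[k] H →ₗ[k] k}

/-- The algebra map `x ↦ R(x ⊗ -)`, with values regarded in `H`. -/
def IsBicharacter.unitForm (hR : IsBicharacter R) : H →ₐ[k] WithConv (H →ₗ[k] H) :=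
  AlgHom.ofLinearMap
    ((WithConv.linearEquiv k (H →ₗ[k] H)).symm.toLinearMap ∘ₗ
      LinearMap.compRight k (Algebra.linearMap k H) ∘ₗ
      (WithConv.linearEquiv k (H →ₗ[k] k)).toLinearMap ∘ₗ leftForm R)
    (by ext y; simp [hR.one_left])
    (by
      intro a b
      ext y
      rw [(ℛ k y).convMul_apply]
      simp [hR.mul_left, (ℛ k y).convMul_apply, -LinearMap.convMul_apply])

@[simp] lemma IsBicharacter.unitForm_apply (hR : IsBicharacter R) (x y : H) :
    hR.unitForm x y = algebraMap k H (R (x ⊗ₜ y)) := rfl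

/-- Both products send `y` to `R(x ⊗ y) a`: one factor is scalar-valued and the other only applies
`ε`. This commutation makes `formConst` and `constForm` algebra maps. -/
lemma IsBicharacter.commute_unitForm (hR : IsBicharacter R) (x a : H) :
    Commute (hR.unitForm x) (constConv (k := k) a) := by
  ext y
  rw [(ℛ k y).convMul_apply, (ℛ k y).convMul_apply]
  have h1 := map_mul_counit_right (ℛ k y) (LinearMap.toSpanSingleton k H a ∘ₗ curry R x)
  have h2 := map_mul_counit_left (ℛ k y) (LinearMap.toSpanSingleton k H a ∘ₗ curry R x)
  simp [Algebra.algebraMap_eq_smul_one, smul_smul] at h1 h2 ⊢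
  rw [h1, ← h2]
  simp [mul_comm]

/-- `x ↦ R(x₁ ⊗ -) x₂`. -/
def IsBicharacter.formConst (hR : IsBicharacter R) : H →ₐ[k] WithConv (H →ₗ[k] H) :=
  (Algebra.TensorProduct.lift hR.unitForm constConv hR.commute_unitForm).comp
    (Bialgebra.comulAlgHom k H)

/-- `x ↦ x₁ R(x₂ ⊗ -)`. -/
def IsBicharacter.constForm (hR : IsBicharacter R) : H →ₐ[k] WithConv (H →ₗ[k] H) :=
  (Algebra.TensorProduct.lift constConv hR.unitForm fun a x => (hR.commute_unitForm x a).symm).comp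
    (Bialgebra.comulAlgHom k H)

lemma IsBicharacter.formConst_eq_sum (hR : IsBicharacter R) {α : Type*} {x : H}
    (rx : Repr k x α) :
    hR.formConst x = ∑ i ∈ rx.index, hR.unitForm (rx.left i) * constConv (rx.right i) := by
  simp [formConst, ← rx.eq]

lemma IsBicharacter.constForm_eq_sum (hR : IsBicharacter R) {α : Type*} {x : H}
    (rx : Repr k x α) :
    hR.constForm x = ∑ i ∈ rx.index, constConv (rx.left i) * hR.unitForm (rx.right i) := by
  simp [constForm, ← rx.eq]

lemma IsBicharacter.formConst_mul_id_apply (hR : IsBicharacter R) {α β : Type*} {x y : H}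
    (rx : Repr k x α) (ry : Repr k y β) :
    (hR.formConst x * toConv LinearMap.id : WithConv (H →ₗ[k] H)) y = ∑ i ∈ rx.index, ∑ j ∈ ry.index,
      algebraMap k H (R (rx.left i ⊗ₜ ry.left j)) * (rx.right i * ry.right j) := by
  rw [hR.formConst_eq_sum rx, Finset.sum_mul]
  simp only [WithConv.ofConv_sum, LinearMap.sum_apply, mul_assoc]
  refine Finset.sum_congr rfl fun i _ => ?_
  rw [ry.convMul_apply]
  simp only [constConv_mul_id, hR.unitForm_apply]

lemma IsBicharacter.id_mul_constForm_apply (hR : IsBicharacter R) {α β : Type*} {x y : H}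
    (rx : Repr k x α) (ry : Repr k y β) :
    (toConv LinearMap.id * hR.constForm x : WithConv (H →ₗ[k] H)) y = ∑ i ∈ rx.index, ∑ j ∈ ry.index,
      ry.left j * rx.left i * algebraMap k H (R (rx.right i ⊗ₜ ry.right j)) := by
  rw [hR.constForm_eq_sum rx, Finset.mul_sum]
  simp only [WithConv.ofConv_sum, LinearMap.sum_apply, ← mul_assoc]
  refine Finset.sum_congr rfl fun i _ => ?_
  rw [ry.convMul_apply]
  simp only [id_mul_constConv, hR.unitForm_apply]

/-- Evaluated at `y`, the hypothesis reads `R(x₁ ⊗ y₁) x₂ y₂ = y₁ x₁ R(x₂ ⊗ y₂)`. Its form in terms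
of algebra maps in `x` is the one suited to induction. -/
lemma IsBicharacter.quasiComm_of (hR : IsBicharacter R)
    (h : ∀ x, hR.formConst x * toConv LinearMap.id = toConv LinearMap.id * hR.constForm x) :
    toConv (unitComp R) * toConv (LinearMap.mul' k H) =
      toConv (flip (LinearMap.mul' k H)) * toConv (unitComp R) := by
  apply WithConv.ofConv_injective
  ext x y
  have := DFunLike.congr_fun (congrArg WithConv.ofConv (h x)) y
  rw [hR.formConst_mul_id_apply (ℛ k x) (ℛ k y),
    hR.id_mul_constForm_apply (ℛ k x) (ℛ k y)] at this
  simp only [AlgebraTensorModule.curry_apply, curry_apply, LinearMap.restrictScalars_self]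
  rw [convMul_tmul (ℛ k x) (ℛ k y), convMul_tmul (ℛ k x) (ℛ k y)]
  simpa [unitComp, flip] using this

/-! ### Legs -/

lemma leg12_tmul (f : H ⊗[k] H →ₗ[k] k) (x y z : H) :
    leg12 f ((x ⊗ₜ y) ⊗ₜ z) = f (x ⊗ₜ y) * counit (R := k) z := by simp [leg12]

lemma leg23_tmul (f : H ⊗[k] H →ₗ[k] k) (x y z : H) :
    leg23 f ((x ⊗ₜ y) ⊗ₜ z) = counit (R := k) x * f (y ⊗ₜ z) := by simp [leg23]

lemma leg13_tmul (f : H ⊗[k] H →ₗ[k] k) (x y z : H) :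
    leg13 f ((x ⊗ₜ y) ⊗ₜ z) = counit (R := k) y * f (x ⊗ₜ z) := by simp [leg13, leg23_tmul]

lemma IsBicharacter.mulId_eq (hR : IsBicharacter R) :
    toConv (R ∘ₗ mulId) = toConv (leg13 R) * toConv (leg23 R) := by
  apply WithConv.ofConv_injective
  ext x y z
  simp only [AlgebraTensorModule.curry_apply, curry_apply, LinearMap.restrictScalars_self]
  rw [convMul_tmul ((ℛ k x).tmul (ℛ k y)) (ℛ k z)]
  have h : R ((x * y) ⊗ₜ z) = (leftForm R x * leftForm R y) z := by rw [← hR.mul_left]; rfl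
  rw [(ℛ k z).convMul_apply] at h
  simp only [leftForm_apply] at h
  simp only [LinearMap.comp_apply, mulId, LinearMap.rTensor_tmul,
    LinearMap.mul'_apply, h]
  change _ = ∑ p ∈ (ℛ k x).index ×ˢ (ℛ k y).index, ∑ j ∈ (ℛ k z).index,
    leg13 R (((ℛ k x).left p.1 ⊗ₜ (ℛ k y).left p.2) ⊗ₜ (ℛ k z).left j) *
    leg23 R (((ℛ k x).right p.1 ⊗ₜ (ℛ k y).right p.2) ⊗ₜ (ℛ k z).right j)
  simp only [leg13_tmul, leg23_tmul]
  rw [Finset.sum_comm]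
  refine Finset.sum_congr rfl fun j _ => ?_
  have hx := map_mul_counit_right (ℛ k x) (curry (flip R) ((ℛ k z).left j))
  have hy := map_mul_counit_left (ℛ k y) (curry (flip R) ((ℛ k z).right j))
  simp only [flip, curry_apply, LinearMap.comp_apply, LinearEquiv.coe_coe, comm_tmul,
    smul_eq_mul] at hx hy
  rw [← hx, ← hy, Finset.sum_mul_sum, Finset.sum_product]
  refine Finset.sum_congr rfl fun a _ => Finset.sum_congr rfl fun b _ => by ring

lemma IsBicharacter.idMul_eq (hR : IsBicharacter R) :
    toConv (R ∘ₗ idMul) = toConv (leg13 R) * toConv (leg12 R) := by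
  apply WithConv.ofConv_injective
  ext x y z
  simp only [AlgebraTensorModule.curry_apply, curry_apply, LinearMap.restrictScalars_self]
  rw [convMul_tmul ((ℛ k x).tmul (ℛ k y)) (ℛ k z)]
  have h : R (x ⊗ₜ (y * z)) = (rightForm R z * rightForm R y) x := by rw [← hR.mul_right]; rfl
  rw [(ℛ k x).convMul_apply] at h
  simp only [rightForm_apply] at h
  simp only [LinearMap.comp_apply, idMul, LinearMap.lTensor_tmul,
    LinearMap.mul'_apply, LinearEquiv.coe_coe, assoc_tmul, h]
  change _ = ∑ p ∈ (ℛ k x).index ×ˢ (ℛ k y).index, ∑ j ∈ (ℛ k z).index,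
    leg13 R (((ℛ k x).left p.1 ⊗ₜ (ℛ k y).left p.2) ⊗ₜ (ℛ k z).left j) *
    leg12 R (((ℛ k x).right p.1 ⊗ₜ (ℛ k y).right p.2) ⊗ₜ (ℛ k z).right j)
  simp only [leg13_tmul, leg12_tmul]
  rw [Finset.sum_product]
  refine Finset.sum_congr rfl fun i _ => ?_
  have hz := map_mul_counit_right (ℛ k z) (curry R ((ℛ k x).left i))
  have hy := map_mul_counit_left (ℛ k y) (curry R ((ℛ k x).right i))
  simp only [curry_apply, smul_eq_mul] at hz hy
  rw [← hz, ← hy, Finset.sum_mul_sum, Finset.sum_comm]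
  refine Finset.sum_congr rfl fun a _ => Finset.sum_congr rfl fun b _ => by ring

/-- With `leg12_convOne`, this makes `leg12` carry convolution inverses to convolution inverses. -/
lemma leg12_convMul (f g : WithConv (H ⊗[k] H →ₗ[k] k)) :
    toConv (leg12 (f * g).ofConv) = toConv (leg12 f.ofConv) * toConv (leg12 g.ofConv) := by
  apply WithConv.ofConv_injective
  ext x y z
  simp only [AlgebraTensorModule.curry_apply, curry_apply, LinearMap.restrictScalars_self]
  rw [convMul_tmul ((ℛ k x).tmul (ℛ k y)) (ℛ k z)]
  simp only [leg12_tmul]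
  rw [((ℛ k x).tmul (ℛ k y)).convMul_apply, Finset.sum_mul]
  refine Finset.sum_congr rfl fun p _ => ?_
  change _ = ∑ j ∈ (ℛ k z).index,
    leg12 f.ofConv (((ℛ k x).left p.1 ⊗ₜ (ℛ k y).left p.2) ⊗ₜ (ℛ k z).left j) *
    leg12 g.ofConv (((ℛ k x).right p.1 ⊗ₜ (ℛ k y).right p.2) ⊗ₜ (ℛ k z).right j)
  simp only [leg12_tmul]
  rw [← map_mul_counit_left (ℛ k z) (counit (R := k) (A := H)), Finset.mul_sum]
  refine Finset.sum_congr rfl fun j _ => ?_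
  simp only [smul_eq_mul]
  change f.ofConv ((ℛ k x).left p.1 ⊗ₜ (ℛ k y).left p.2) *
    g.ofConv ((ℛ k x).right p.1 ⊗ₜ (ℛ k y).right p.2) * _ = _
  ring

lemma leg12_convOne : toConv (leg12 (1 : WithConv (H ⊗[k] H →ₗ[k] k)).ofConv) = 1 := by
  apply WithConv.ofConv_injective
  ext x y z
  simp [leg12_tmul]
  ring

lemma leg23_convMul (f g : WithConv (H ⊗[k] H →ₗ[k] k)) :
    toConv (leg23 (f * g).ofConv) = toConv (leg23 f.ofConv) * toConv (leg23 g.ofConv) := by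
  apply WithConv.ofConv_injective
  ext x y z
  simp only [AlgebraTensorModule.curry_apply, curry_apply, LinearMap.restrictScalars_self]
  rw [convMul_tmul ((ℛ k x).tmul (ℛ k y)) (ℛ k z)]
  simp only [leg23_tmul]
  change _ = ∑ p ∈ (ℛ k x).index ×ˢ (ℛ k y).index, ∑ j ∈ (ℛ k z).index,
    leg23 f.ofConv (((ℛ k x).left p.1 ⊗ₜ (ℛ k y).left p.2) ⊗ₜ (ℛ k z).left j) *
    leg23 g.ofConv (((ℛ k x).right p.1 ⊗ₜ (ℛ k y).right p.2) ⊗ₜ (ℛ k z).right j)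
  simp only [leg23_tmul]
  rw [convMul_tmul (ℛ k y) (ℛ k z), Finset.sum_product,
    ← map_mul_counit_left (ℛ k x) (counit (R := k) (A := H)), Finset.sum_mul]
  refine Finset.sum_congr rfl fun i _ => ?_
  rw [Finset.mul_sum]
  refine Finset.sum_congr rfl fun j _ => ?_
  rw [Finset.mul_sum]
  refine Finset.sum_congr rfl fun l _ => ?_
  simp only [smul_eq_mul]
  ring

lemma leg23_convOne : toConv (leg23 (1 : WithConv (H ⊗[k] H →ₗ[k] k)).ofConv) = 1 := by
  apply WithConv.ofConv_injective
  ext x y z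
  simp [leg23_tmul]
  ring

lemma leg12_convInv_mul (hR : IsUnit (toConv R)) :
    toConv (leg12 (convInv R)) * toConv (leg12 R) = 1 := by
  rw [← leg12_convOne, ← Ring.inverse_mul_cancel _ hR, leg12_convMul]
  rfl

lemma leg23_convInv_mul (hR : IsUnit (toConv R)) :
    toConv (leg23 (convInv R)) * toConv (leg23 R) = 1 := by
  rw [← leg23_convOne, ← Ring.inverse_mul_cancel _ hR, leg23_convMul]
  rfl

end Bialgebra

/-! ### Cocentral forms -/

section Cocentral

variable {k C D : Type*} [Field k] [AddCommGroup C] [Module k C] [Coalgebra k C]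
  [AddCommGroup D] [Module k D] [Coalgebra k D]

/-- A linear form `φ` on a coalgebra with `φ(x₁) x₂ = x₁ φ(x₂)`. -/
def IsCocentral (φ : C →ₗ[k] k) : Prop :=
  ∀ x, TensorProduct.lid k C (LinearMap.rTensor C φ (comul x)) =
    TensorProduct.rid k C (LinearMap.lTensor C φ (comul x))

lemma isCocentral_iff_sum {φ : C →ₗ[k] k} : IsCocentral φ ↔
    ∀ x, ∑ i ∈ (ℛ k x).index, φ ((ℛ k x).left i) • (ℛ k x).right i =
      ∑ i ∈ (ℛ k x).index, φ ((ℛ k x).right i) • (ℛ k x).left i := by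
  refine forall_congr' fun x => ?_
  rw [← (ℛ k x).eq]
  simp

lemma isCocentral_counit : IsCocentral (counit (R := k) (A := C)) := by
  intro x
  simp

lemma IsCocentral.smul {φ : C →ₗ[k] k} (h : IsCocentral φ) (t : k) : IsCocentral (t • φ) := by
  intro x
  simp [LinearMap.rTensor_smul, LinearMap.lTensor_smul, h x]

lemma IsCocentral.tmul {φ : C →ₗ[k] k} {ψ : D →ₗ[k] k} (hφ : IsCocentral φ) (hψ : IsCocentral ψ) :
    IsCocentral (LinearMap.mul' k k ∘ₗ TensorProduct.map φ ψ) := by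
  intro z
  induction z using TensorProduct.induction_on with
  | zero => simp
  | add z w hz hw => simp only [map_add, hz, hw]
  | tmul x y =>
    have := congrArg₂ (fun a b => a ⊗ₜ[k] b) (isCocentral_iff_sum.1 hφ x)
      (isCocentral_iff_sum.1 hψ y)
    rw [TensorProduct.comul_tmul, ← (ℛ k x).eq, ← (ℛ k y).eq]
    simpa [sum_tmul, tmul_sum, smul_tmul, Finset.smul_sum, smul_smul, mul_comm] using this

lemma IsCocentral.convMul_comm {B : Type*} [Ring B] [Algebra k B] {φ : C →ₗ[k] k}
    (h : IsCocentral φ) (f : C →ₗ[k] B) :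
    toConv (Algebra.linearMap k B ∘ₗ φ) * toConv f =
      toConv f * toConv (Algebra.linearMap k B ∘ₗ φ) := by
  ext x
  rw [(ℛ k x).convMul_apply, (ℛ k x).convMul_apply]
  have := congrArg f (isCocentral_iff_sum.1 h x)
  simpa [Algebra.smul_def, Algebra.commutes] using this

lemma IsCocentral.commute {φ : C →ₗ[k] k} (h : IsCocentral φ) (f : WithConv (C →ₗ[k] k)) :
    Commute (toConv φ) f :=
  h.convMul_comm f.ofConv

end Cocentral

/-! ### Cartier forms from cocentral derivations. -/

section Derivation

variable {k H : Type*} [Field k] [Ring H] [Bialgebra k H] {R : H ⊗[k] H →ₗ[k] k}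

/-- For a coquasitriangular bialgebra `(H, R)` and a cocentral `ε`-derivation `d`, the form
`t d ⊗ d` is Cartier. -/
theorem IsUniversalRForm.isCartier_smul_map (hR : IsUniversalRForm R) {d : H →ₗ[k] k}
    (hd : ∀ x y, d (x * y) = d x * counit (R := k) y + counit (R := k) x * d y)
    (hc : IsCocentral d) (t : k) :
    IsCartier R (t • (LinearMap.mul' k k ∘ₗ TensorProduct.map d d)) := by
  set χ : H ⊗[k] H →ₗ[k] k := t • (LinearMap.mul' k k ∘ₗ TensorProduct.map d d) with hχ
  have χ_tmul : ∀ x y, χ (x ⊗ₜ y) = t * (d x * d y) := fun x y => by simp [hχ]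
  have χc : IsCocentral χ := (hc.tmul hc).smul t
  -- The middle leg is the counit, itself cocentral, so `χ₁₃` is a tensor product of three cocentral
  -- forms.
  have e13 : leg13 χ = t • (LinearMap.mul' k k ∘ₗ
      TensorProduct.map (LinearMap.mul' k k ∘ₗ TensorProduct.map d counit) d) := by
    ext x y z
    simp [leg13_tmul, χ_tmul]
    ring
  have c13 : IsCocentral (leg13 χ) := by
    rw [e13]
    exact ((hc.tmul isCocentral_counit).tmul hc).smul t
  refine ⟨⟨hR, χc.convMul_comm _, ?_, ?_⟩, ?_⟩
  -- Centrality of `χ₁₃` cancels `R₁₂` against its inverse, leaving `χ(id ⊗ m) = χ₁₂ + χ₁₃`, the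
  -- Leibniz rule in the second argument.
  · rw [mul_assoc, (c13.commute _).eq, ← mul_assoc, leg12_convInv_mul hR.isUnit, one_mul,
      ← WithConv.toConv_add]
    congr 1
    ext x y z
    simp [idMul, leg13_tmul, leg12_tmul, χ_tmul, hd]
    ring
  · rw [mul_assoc, (c13.commute _).eq, ← mul_assoc, leg23_convInv_mul hR.isUnit, one_mul,
      ← WithConv.toConv_add]
    congr 1
    ext x y z
    simp [mulId, leg13_tmul, leg23_tmul, χ_tmul, hd]
    ring
  · have : flip χ = χ := by
      ext x y
      simp [flip, χ_tmul, mul_comm]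
    rw [this]
    exact (χc.commute _).eq.symm

end Derivation

end Cartier

/-! ### Pullback of bicharacters, and derivations induced by `ε`-derivations. -/

namespace Cartier

open Coalgebra

section

variable {k H H' : Type*} [Field k] [Ring H] [Bialgebra k H] [Ring H'] [Bialgebra k H']

lemma IsBicharacter.comp_map {R : H' ⊗[k] H' →ₗ[k] k} (hR : IsBicharacter R) (φ : H →ₐc[k] H') :
    IsBicharacter (R ∘ₗ TensorProduct.map (φ : H →ₗ[k] H') (φ : H →ₗ[k] H')) := by
  have hl : ∀ x, leftForm (R ∘ₗ TensorProduct.map (φ : H →ₗ[k] H') (φ : H →ₗ[k] H')) x =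
      toConv ((leftForm R (φ x)).ofConv ∘ₗ (φ : H →ₗc[k] H').toLinearMap) := fun x => rfl
  have hr : ∀ x, rightForm (R ∘ₗ TensorProduct.map (φ : H →ₗ[k] H') (φ : H →ₗ[k] H')) x =
      toConv ((rightForm R (φ x)).ofConv ∘ₗ (φ : H →ₗc[k] H').toLinearMap) := fun x => rfl
  refine ⟨?_, ?_, fun x y => ?_, fun x y => ?_⟩
  · rw [hl, map_one, hR.one_left]
    ext y
    simp
  · rw [hr, map_one, hR.one_right]
    ext y
    simp
  · rw [hl, map_mul, hR.mul_left, LinearMap.convMul_comp_coalgHom_distrib, hl, hl]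
  · rw [hr, map_mul, hR.mul_right, LinearMap.convMul_comp_coalgHom_distrib, hr, hr]

variable {d : H →ₗ[k] k}

/-- An `ε`-derivation `d` induces an honest derivation `x ↦ d(x₁) x₂` of `H`. -/
lemma lid_rTensor_comul_mul
    (hd : ∀ x y, d (x * y) = d x * counit (R := k) y + counit (R := k) x * d y) (x y : H) :
    TensorProduct.lid k H (LinearMap.rTensor H d (comul (x * y))) =
      TensorProduct.lid k H (LinearMap.rTensor H d (comul x)) * y +
        x * TensorProduct.lid k H (LinearMap.rTensor H d (comul y)) := by
  have hx := map_mul_counit_left (ℛ k x) LinearMap.id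
  have hy := map_mul_counit_left (ℛ k y) LinearMap.id
  simp only [LinearMap.id_apply] at hx hy
  -- Expanding the bare factors as `ε(y₁) y₂` and `ε(x₁) x₂` puts both sides over the same double
  -- sum.
  conv_rhs => enter [1, 2]; rw [← hy]
  conv_rhs => enter [2, 1]; rw [← hx]
  rw [Bialgebra.comul_mul, ← (ℛ k x).eq, ← (ℛ k y).eq]
  simp [Finset.sum_mul_sum, hd, add_smul, Finset.sum_add_distrib, smul_smul, mul_comm]

lemma rid_lTensor_comul_mul
    (hd : ∀ x y, d (x * y) = d x * counit (R := k) y + counit (R := k) x * d y) (x y : H) :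
    TensorProduct.rid k H (LinearMap.lTensor H d (comul (x * y))) =
      TensorProduct.rid k H (LinearMap.lTensor H d (comul x)) * y +
        x * TensorProduct.rid k H (LinearMap.lTensor H d (comul y)) := by
  have hx := map_mul_counit_right (ℛ k x) LinearMap.id
  have hy := map_mul_counit_right (ℛ k y) LinearMap.id
  simp only [LinearMap.id_apply] at hx hy
  conv_rhs => enter [1, 2]; rw [← hy]
  conv_rhs => enter [2, 1]; rw [← hx]
  rw [Bialgebra.comul_mul, ← (ℛ k x).eq, ← (ℛ k y).eq]
  simp [Finset.sum_mul_sum, hd, add_smul, Finset.sum_add_distrib, smul_smul, mul_comm]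

end

end Cartier

/-! ### The FRT bialgebra: derivation, bicharacter, quasi-commutativity and inverse. -/

namespace FRTAlgebra

open Coalgebra Cartier

variable {k ι : Type*} [Field k] [Fintype ι] {γ : ι → ι → ι → ι → k}

/-- The matrix `(R(T_i^p ⊗ y))_{i,p}`. -/
def formMatrix (R : FRTAlgebra γ ⊗[k] FRTAlgebra γ →ₗ[k] k) :
    FRTAlgebra γ →ₗ[k] Matrix ι ι k where
  toFun y := Matrix.of fun i p => R (T γ i p ⊗ₜ y)
  map_add' x y := by ext; simp [tmul_add]
  map_smul' r x := by ext; simp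

@[simp] lemma formMatrix_apply (R : FRTAlgebra γ ⊗[k] FRTAlgebra γ →ₗ[k] k) (y : FRTAlgebra γ) (i p : ι) :
    formMatrix R y i p = R (T γ i p ⊗ₜ y) := rfl

variable [DecidableEq ι]

/-! ### The derivation -/

/-- Two algebra maps agreeing on generators. Knowing the first component is what turns
multiplication of dual numbers into the Leibniz rule over `ε`. -/
lemma fst_dualHom (x : FRTAlgebra γ) : (dualHom γ x).fst = counit (R := k) x := by
  have : (TrivSqZeroExt.fstHom k k k).comp (dualHom γ) = Bialgebra.counitAlgHom k _ := by
    apply algHom_ext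
    intro i j
    simp only [AlgHom.comp_apply, dualHom, lift_T, Bialgebra.counitAlgHom_apply, counit_T]
    split_ifs <;> simp
  exact DFunLike.congr_fun this x

lemma degDeriv_mul (x y : FRTAlgebra γ) : degDeriv γ (x * y) =
    degDeriv γ x * counit (R := k) y + counit (R := k) x * degDeriv γ y := by
  simp [degDeriv, TrivSqZeroExt.snd_mul, fst_dualHom, mul_comm, add_comm]

lemma degDeriv_algebraMap (r : k) : degDeriv γ (algebraMap k _ r) = 0 := by
  simp [degDeriv, TrivSqZeroExt.algebraMap_eq_inl]

lemma degDeriv_one : degDeriv γ 1 = 0 := by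
  simpa using degDeriv_algebraMap (γ := γ) 1

lemma degDeriv_T (i j : ι) : degDeriv γ (T γ i j) = if i = j then 1 else 0 := by
  simp only [degDeriv, LinearMap.comp_apply, AlgHom.toLinearMap_apply, dualHom, lift_T]
  split_ifs <;> simp

lemma degDeriv_monomial (w : List (ι × ι)) :
    degDeriv γ (monomial γ w) = (w.length : k) * counit (R := k) (monomial γ w) := by
  induction w with
  | nil => simp [monomial, degDeriv_one]
  | cons a w ih =>
    have : monomial γ (a :: w) = T γ a.1 a.2 * monomial γ w := by simp [monomial]
    rw [this, degDeriv_mul, ih, degDeriv_T, Bialgebra.counit_mul, counit_T]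
    push_cast [List.length_cons]
    ring

lemma isCocentral_degDeriv : IsCocentral (degDeriv γ) := by
  intro x
  induction x using induction_on with
  | hr r => simp [Algebra.algebraMap_eq_smul_one, Algebra.TensorProduct.one_def]
  | hT i j => simp [comul_T, degDeriv_T, ite_smul]
  | hadd x y hx hy => simp only [map_add, hx, hy]
  | hmul x y hx hy =>
    rw [lid_rTensor_comul_mul degDeriv_mul, rid_lTensor_comul_mul degDeriv_mul, hx, hy]

/-! ### The universal `R`-form -/

variable (γ) in
/-- `Δ(T_i^j) = ∑ T_i^s ⊗ T_s^j`. -/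
def reprT (i j : ι) : Repr k (T γ i j) ι where
  index := Finset.univ
  left s := T γ i s
  right s := T γ s j
  eq := (comul_T γ i j).symm

@[simp] lemma reprT_index (i j : ι) : (reprT γ i j).index = Finset.univ := rfl
@[simp] lemma reprT_left (i j s : ι) : (reprT γ i j).left s = T γ i s := rfl
@[simp] lemma reprT_right (i j s : ι) : (reprT γ i j).right s = T γ s j := rfl

lemma leftForm_rForm (hγ : CoeffBraid γ) (x : FRTAlgebra γ) :
    leftForm (rForm γ hγ) x = rHom γ hγ x := rfl

lemma rForm_T_tmul (hγ : CoeffBraid γ) (i p : ι) (x : FRTAlgebra γ) :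
    rForm γ hγ (T γ i p ⊗ₜ x) = rRow γ hγ i p x := by
  change (rHom γ hγ (T γ i p)).ofConv x = _
  simp [rHom]

lemma rForm_T_tmul_T (hγ : CoeffBraid γ) (i p j q : ι) :
    rForm γ hγ (T γ i p ⊗ₜ T γ j q) = γ j i p q := by
  rw [rForm_T_tmul, rRow_T]

lemma rForm_one_tmul (hγ : CoeffBraid γ) (x : FRTAlgebra γ) :
    rForm γ hγ (1 ⊗ₜ x) = counit (R := k) x := by
  change (rHom γ hγ 1).ofConv x = _
  simp

lemma rForm_mul_tmul (hγ : CoeffBraid γ) (x y : FRTAlgebra γ) {α : Type*} {z : FRTAlgebra γ}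
    (rz : Repr k z α) : rForm γ hγ ((x * y) ⊗ₜ z) =
      ∑ i ∈ rz.index, rForm γ hγ (x ⊗ₜ rz.left i) * rForm γ hγ (y ⊗ₜ rz.right i) := by
  change (rHom γ hγ (x * y)).ofConv z = _
  rw [map_mul, rz.convMul_apply]
  rfl

lemma rForm_tmul_one (hγ : CoeffBraid γ) (x : FRTAlgebra γ) :
    rForm γ hγ (x ⊗ₜ 1) = counit (R := k) x := by
  induction x using induction_on with
  | hr r => simp [Algebra.algebraMap_eq_smul_one, ← smul_tmul', rForm_one_tmul]
  | hT i j => rw [rForm_T_tmul, rRow_one, counit_T]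
  | hadd x y hx hy => simp only [add_tmul, map_add, hx, hy]
  | hmul x y hx hy =>
    have h : leftForm (rForm γ hγ) (x * y) 1 =
        (leftForm (rForm γ hγ) x * leftForm (rForm γ hγ) y) 1 := by
      simp only [leftForm_rForm, map_mul]
    simpa [Algebra.TensorProduct.one_def, hx, hy] using h

/-- On generators this is multiplicativity of `rMatrix` into the opposite matrix algebra. For a
product `x x'`, both sides expand to `R(x₁ ⊗ z₁) R(x₂ ⊗ y₁) R(x'₁ ⊗ z₂) R(x'₂ ⊗ y₂)`. -/
lemma rForm_tmul_mul (hγ : CoeffBraid γ) (x y z : FRTAlgebra γ) :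
    rForm γ hγ (x ⊗ₜ (y * z)) = (rightForm (rForm γ hγ) z * rightForm (rForm γ hγ) y) x := by
  induction x using induction_on generalizing y z with
  | hr r =>
    simp [Algebra.algebraMap_eq_smul_one, ← smul_tmul', rForm_one_tmul,
      Algebra.TensorProduct.one_def, mul_comm]
  | hT i j =>
    rw [(reprT γ i j).convMul_apply]
    simp [rForm_T_tmul, rRow_mul]
  | hadd x x' hx hx' => simp only [add_tmul, map_add, hx, hx']
  | hmul x x' hx hx' =>
    rw [rForm_mul_tmul hγ x x' ((ℛ k y).mul (ℛ k z)), ((ℛ k x).mul (ℛ k x')).convMul_apply]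
    simp only [rightForm_apply]
    change ∑ p ∈ (ℛ k y).index ×ˢ (ℛ k z).index,
        rForm γ hγ (x ⊗ₜ ((ℛ k y).left p.1 * (ℛ k z).left p.2)) *
        rForm γ hγ (x' ⊗ₜ ((ℛ k y).right p.1 * (ℛ k z).right p.2)) =
      ∑ p ∈ (ℛ k x).index ×ˢ (ℛ k x').index,
        rForm γ hγ (((ℛ k x).left p.1 * (ℛ k x').left p.2) ⊗ₜ z) *
        rForm γ hγ (((ℛ k x).right p.1 * (ℛ k x').right p.2) ⊗ₜ y)
    simp only [hx, hx', rForm_mul_tmul hγ _ _ (ℛ k y), rForm_mul_tmul hγ _ _ (ℛ k z),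
      (ℛ k x).convMul_apply, (ℛ k x').convMul_apply, rightForm_apply, Finset.sum_product,
      Finset.sum_mul_sum]
    have e : ∀ {α β α' β' : Type _} (s : Finset α) (t : Finset β) (s' : Finset α')
        (t' : Finset β') (f : α → β → α' → β' → k),
        ∑ a ∈ s, ∑ b ∈ t, ∑ a' ∈ s', ∑ b' ∈ t', f a b a' b' =
          ∑ a' ∈ s', ∑ b' ∈ t', ∑ b ∈ t, ∑ a ∈ s, f a b a' b' := by
      intro α β α' β' s t s' t' f
      have := Finset.sum_comm (s := s ×ˢ t) (t := s' ×ˢ t') (f := fun x y => f x.1 x.2 y.1 y.2)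
      simp only [Finset.sum_product] at this
      rw [this]
      refine Finset.sum_congr rfl fun a _ => Finset.sum_congr rfl fun b _ => Finset.sum_comm
    rw [e]
    refine Finset.sum_congr rfl fun a _ => Finset.sum_congr rfl fun b _ =>
      Finset.sum_congr rfl fun c _ => Finset.sum_congr rfl fun d _ => by ring

lemma isBicharacter_rForm (hγ : CoeffBraid γ) : IsBicharacter (rForm γ hγ) where
  one_left := by simp [leftForm_rForm]
  one_right := by ext x; simp [rForm_tmul_one]
  mul_left x y := by simp [leftForm_rForm]
  mul_right x y := by
    ext z
    rw [rightForm_apply, rForm_tmul_mul]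

/-! ### Reduction to generators through matrices of forms. -/

section Bicharacter

variable {R S : FRTAlgebra γ ⊗[k] FRTAlgebra γ →ₗ[k] k}

lemma formMatrix_one (hR : IsBicharacter R) : formMatrix R 1 = 1 := by
  ext i p
  have : R (T γ i p ⊗ₜ 1) = rightForm R 1 (T γ i p) := rfl
  simp [this, hR.one_right, counit_T, Matrix.one_apply]

lemma formMatrix_mul (hR : IsBicharacter R) (x y : FRTAlgebra γ) :
    formMatrix R (x * y) = formMatrix R y * formMatrix R x := by
  ext i p
  have : R (T γ i p ⊗ₜ (x * y)) = rightForm R (x * y) (T γ i p) := rfl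
  rw [formMatrix_apply, this, hR.mul_right, (reprT γ i p).convMul_apply, Matrix.mul_apply]
  rfl

lemma formMatrix_flip_one (hR : IsBicharacter R) : formMatrix (Cartier.flip R) 1 = 1 := by
  ext i p
  have : Cartier.flip R (T γ i p ⊗ₜ 1) = leftForm R 1 (T γ i p) := rfl
  simp [this, hR.one_left, counit_T, Matrix.one_apply]

lemma formMatrix_flip_mul (hR : IsBicharacter R) (x y : FRTAlgebra γ) :
    formMatrix (Cartier.flip R) (x * y) =
      formMatrix (Cartier.flip R) x * formMatrix (Cartier.flip R) y := by
  ext i p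
  have : Cartier.flip R (T γ i p ⊗ₜ (x * y)) = leftForm R (x * y) (T γ i p) := rfl
  rw [formMatrix_apply, this, hR.mul_left, (reprT γ i p).convMul_apply, Matrix.mul_apply]
  rfl

/-- First half of a double induction: the first argument ranges over generators, collected in a
matrix, while `y` is arbitrary. -/
lemma formMatrix_convMul_flip (hR : IsBicharacter R) (hS : IsBicharacter S)
    (h : ∀ i p j q, ∑ s, ∑ t, R (T γ i s ⊗ₜ T γ j t) * S (T γ t q ⊗ₜ T γ s p) =
      if i = p ∧ j = q then 1 else 0) (y : FRTAlgebra γ) :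
    (toConv (formMatrix R) * toConv (formMatrix (Cartier.flip S))) y =
      algebraMap k _ (counit (R := k) y) := by
  induction y using induction_on with
  | hr r =>
    simp [Algebra.algebraMap_eq_smul_one, Algebra.TensorProduct.one_def, formMatrix_one hR,
      formMatrix_flip_one hS]
  | hT j q =>
    rw [(reprT γ j q).convMul_apply]
    ext i p
    simp only [Matrix.sum_apply, Matrix.mul_apply, formMatrix_apply, reprT_index, reprT_left,
      reprT_right, Cartier.flip, LinearMap.comp_apply, LinearEquiv.coe_coe, comm_tmul]
    rw [Finset.sum_comm, h, counit_T, Matrix.algebraMap_matrix_apply]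
    by_cases h1 : i = p <;> by_cases h2 : j = q <;> simp [h1, h2]
  | hadd x y hx hy => simp only [map_add, hx, hy]
  | hmul x y hx hy =>
    exact convMul_mul_eq_of_antihom_hom (formMatrix_mul hR) (formMatrix_flip_mul hS) hx hy

lemma convMul_flip_eq_one (hR : IsBicharacter R) (hS : IsBicharacter S)
    (h : ∀ i p j q, ∑ s, ∑ t, R (T γ i s ⊗ₜ T γ j t) * S (T γ t q ⊗ₜ T γ s p) =
      if i = p ∧ j = q then 1 else 0) :
    toConv R * toConv (Cartier.flip S) = 1 := by
  -- Second half of the double induction, now on the first argument.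
  have key : ∀ x, (toConv (leftForm R) * toConv (rightForm S)) x =
      algebraMap k _ (counit (R := k) x) := by
    intro x
    induction x using induction_on with
    | hr r =>
      simp [Algebra.algebraMap_eq_smul_one, Algebra.TensorProduct.one_def, hR.one_left,
        hS.one_right]
    | hT i p =>
      rw [(reprT γ i p).convMul_apply]
      ext y
      have := congrFun (congrFun (formMatrix_convMul_flip hR hS h y) i) p
      rw [(ℛ k y).convMul_apply] at this
      simp only [Matrix.sum_apply, Matrix.mul_apply, formMatrix_apply, Cartier.flip,
        LinearMap.comp_apply, LinearEquiv.coe_coe, comm_tmul] at this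
      rw [Finset.sum_comm, Matrix.algebraMap_matrix_apply] at this
      simp only [reprT_index, reprT_left, reprT_right, WithConv.ofConv_sum, LinearMap.sum_apply,
        (ℛ k y).convMul_apply, leftForm_apply, rightForm_apply]
      rw [this, counit_T]
      split_ifs <;> simp
    | hadd x y hx hy => simp only [map_add, hx, hy]
    | hmul x y hx hy => exact convMul_mul_eq_of_hom_antihom hR.mul_left hS.mul_right hx hy
  apply WithConv.ofConv_injective
  ext x y
  have h1 := (leftForm_convMul (toConv R) (toConv (Cartier.flip S)) x).trans (key x)
  have h2 := DFunLike.congr_fun (congrArg WithConv.ofConv h1) y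
  simpa [mul_comm, -LinearMap.convMul_apply] using h2

/-- The `(i, p)` entry is quasi-commutativity for `T_i^p` against `y`; at `y = T_j^q` it is the FRT
relation. The scalar-valued entries of the form matrix commute with the scalar matrices of `y`, as
`convMul_mul_exchange` requires. -/
lemma formMatrix_exchange (hγ : CoeffBraid γ) (y : FRTAlgebra γ) :
    (toConv ((Algebra.linearMap k (FRTAlgebra γ)).mapMatrix ∘ₗ formMatrix (rForm γ hγ)) *
      toConv (LinearMap.mulLeft k (Matrix.of (T γ)) ∘ₗ
        (Matrix.scalarAlgHom ι k).toLinearMap)) y =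
    (toConv (Matrix.scalarAlgHom (α := FRTAlgebra γ) ι k).toLinearMap *
      toConv (LinearMap.mulLeft k (Matrix.of (T γ)) ∘ₗ
        (Algebra.linearMap k (FRTAlgebra γ)).mapMatrix ∘ₗ formMatrix (rForm γ hγ))) y := by
  have hR := isBicharacter_rForm hγ
  induction y using induction_on with
  | hr r =>
    simp [Algebra.algebraMap_eq_smul_one, Algebra.TensorProduct.one_def, formMatrix_one hR]
  | hT j q =>
    rw [(reprT γ j q).convMul_apply, (reprT γ j q).convMul_apply]
    ext i p
    have := T_rel γ j i p q
    simp only [Algebra.smul_def, Algebra.commutes (_ : k) (T γ j _ * T γ i _)] at this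
    simp [Matrix.sum_apply, Matrix.mul_apply, Matrix.diagonal_apply, rForm_T_tmul_T]
    rw [Finset.sum_comm, this]
    simp only [Finset.mul_sum, mul_assoc]
  | hadd x y hx hy => simp only [map_add, hx, hy]
  | hmul x y hx hy =>
    refine convMul_mul_exchange _ (fun x y => ?_) (fun x y => ?_) (fun x y => ?_) hx hy
    · ext i p
      simp [formMatrix_mul hR, Matrix.mul_apply]
    · simp
    · ext i p
      simp [Matrix.mul_apply, Matrix.diagonal_apply, Algebra.commutes]

lemma formConst_mul_id (hγ : CoeffBraid γ) (x : FRTAlgebra γ) :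
    (isBicharacter_rForm hγ).formConst x * toConv LinearMap.id =
      toConv LinearMap.id * (isBicharacter_rForm hγ).constForm x := by
  induction x using induction_on with
  | hr r => simp only [AlgHom.commutes, Algebra.commutes]
  | hT i p =>
    ext y
    have := congrFun (congrFun (formMatrix_exchange hγ y) i) p
    rw [IsBicharacter.formConst_mul_id_apply _ (reprT γ i p) (ℛ k y),
      IsBicharacter.id_mul_constForm_apply _ (reprT γ i p) (ℛ k y)]
    rw [(ℛ k y).convMul_apply, (ℛ k y).convMul_apply] at this
    simp [Matrix.sum_apply, Matrix.mul_apply, Matrix.diagonal_apply] at this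
    simp only [reprT_index, reprT_left, reprT_right]
    rw [Finset.sum_comm, this, Finset.sum_comm]
    simp only [Finset.mul_sum, mul_assoc]
  | hadd x y hx hy => simp only [map_add, add_mul, mul_add, hx, hy]
  | hmul x y hx hy => rw [map_mul, map_mul, mul_assoc, hy, ← mul_assoc, hx, mul_assoc]

end Bicharacter

/-! ### Invertibility -/

section Inverse

variable {δ : ι → ι → ι → ι → k}

/-- `γ` and `δ` are the coefficients of mutually inverse operators. -/
def CoeffInverse (γ δ : ι → ι → ι → ι → k) : Prop :=
  ∀ i j p q, ∑ m, ∑ n, γ i j m n * δ m n p q = if i = p ∧ j = q then 1 else 0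

/-- In matrix form the relations say that the coefficient matrix commutes with `X`, the matrix of
products of two generators; then so does its inverse. -/
lemma T_rel_of_inverse (h : CoeffInverse γ δ) (h' : CoeffInverse δ γ) (i j p q : ι) :
    ∑ m, ∑ n, γ i j m n • (T δ m p * T δ n q) = ∑ m, ∑ n, γ m n p q • (T δ i m * T δ j n) := by
  let E (η : ι → ι → ι → ι → k) : Matrix (ι × ι) (ι × ι) (FRTAlgebra δ) :=
    Matrix.of fun x y => algebraMap k _ (η x.1 x.2 y.1 y.2)
  let X : Matrix (ι × ι) (ι × ι) (FRTAlgebra δ) :=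
    Matrix.of fun x y => T δ x.1 y.1 * T δ x.2 y.2
  have hE : ∀ η θ : ι → ι → ι → ι → k, CoeffInverse η θ → E η * E θ = 1 := by
    intro η θ h
    ext x y
    simp only [E, Matrix.mul_apply, Matrix.of_apply, ← map_mul, ← map_sum, Fintype.sum_prod_type,
      h x.1 x.2 y.1 y.2, Matrix.one_apply, Prod.ext_iff]
    split_ifs <;> simp
  have hl : ∀ η x y, (E η * X) x y =
      ∑ m, ∑ n, η x.1 x.2 m n • (T δ m y.1 * T δ n y.2) := by
    intro η x y
    simp [E, X, Matrix.mul_apply, Fintype.sum_prod_type, Algebra.smul_def]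
  have hr : ∀ η x y, (X * E η) x y =
      ∑ m, ∑ n, η m n y.1 y.2 • (T δ x.1 m * T δ x.2 n) := by
    intro η x y
    simp [E, X, Matrix.mul_apply, Fintype.sum_prod_type, Algebra.smul_def, Algebra.commutes]
  have hX : E δ * X = X * E δ := by
    ext x y
    rw [hl, hr, T_rel]
  have : E γ * X = X * E γ := by
    calc E γ * X = E γ * (X * E δ) * E γ := by simp [mul_assoc, hE δ γ h']
      _ = X * E γ := by rw [← hX, ← mul_assoc, hE γ δ h, one_mul]
  have := congrFun (congrFun this (i, j)) (p, q)
  rwa [hl, hr] at this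

/-- The bialgebra map `A(c) → A(c⁻¹)` fixing the generators. -/
def toInverse (h : CoeffInverse γ δ) (h' : CoeffInverse δ γ) :
    FRTAlgebra γ →ₐc[k] FRTAlgebra δ :=
  BialgHom.ofAlgHom (lift (T δ) (T_rel_of_inverse h h'))
    (by
      apply algHom_ext
      intro i j
      simp [counit_T])
    (by
      apply algHom_ext
      intro i j
      simp [comul_T])

@[simp] lemma toInverse_T (h : CoeffInverse γ δ) (h' : CoeffInverse δ γ) (i j : ι) :
    toInverse h h' (T γ i j) = T δ i j :=
  lift_T _ _ i j

lemma isUnit_rForm (hγ : CoeffBraid γ) (hδ : CoeffBraid δ) (h : CoeffInverse γ δ)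
    (h' : CoeffInverse δ γ) : IsUnit (toConv (rForm γ hγ)) := by
  let φ := toInverse h h'
  let S : FRTAlgebra γ ⊗[k] FRTAlgebra γ →ₗ[k] k := rForm δ hδ ∘ₗ
    TensorProduct.map (φ : FRTAlgebra γ →ₗ[k] FRTAlgebra δ) (φ : FRTAlgebra γ →ₗ[k] FRTAlgebra δ)
  have hR := isBicharacter_rForm hγ
  have hS : IsBicharacter S := (isBicharacter_rForm hδ).comp_map φ
  have S_T : ∀ i p j q, S (T γ i p ⊗ₜ T γ j q) = δ j i p q := by
    intro i p j q
    change rForm δ hδ (toInverse h h' (T γ i p) ⊗ₜ toInverse h h' (T γ j q)) = _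
    rw [toInverse_T, toInverse_T, rForm_T_tmul_T]
  have e1 : toConv (rForm γ hγ) * toConv (Cartier.flip S) = 1 := by
    apply convMul_flip_eq_one hR hS
    intro i p j q
    simp only [S_T, rForm_T_tmul_T, h j i q p, and_comm]
  have e2 : toConv S * toConv (Cartier.flip (rForm γ hγ)) = 1 := by
    apply convMul_flip_eq_one hS hR
    intro i p j q
    simp only [S_T, rForm_T_tmul_T, h' j i q p, and_comm]
  -- The left inverse comes from flipping `e2`, as flipping respects convolution and is involutive.
  have e3 : toConv (Cartier.flip S) * toConv (rForm γ hγ) = 1 := by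
    have := flip_convMul (toConv S) (toConv (Cartier.flip (rForm γ hγ)))
    rw [e2, flip_convOne] at this
    rw [this]
    congr 2
    ext x y
    rfl
  exact ⟨⟨_, _, e1, e3⟩, rfl⟩

end Inverse

lemma isUniversalRForm_rForm {δ : ι → ι → ι → ι → k} (hγ : CoeffBraid γ) (hδ : CoeffBraid δ)
    (h : CoeffInverse γ δ) (h' : CoeffInverse δ γ) : IsUniversalRForm (rForm γ hγ) where
  isUnit := isUnit_rForm hγ hδ h h'
  quasiComm := (isBicharacter_rForm hγ).quasiComm_of (formConst_mul_id hγ)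
  idMul_eq := (isBicharacter_rForm hγ).idMul_eq
  mulId_eq := (isBicharacter_rForm hγ).mulId_eq

end FRTAlgebra

/-! ### The inverse braiding and its coefficients. -/

section Braided

variable {k V ι : Type*} [Field k] [AddCommGroup V] [Module k V] [Fintype ι]

lemma op12_mul (c d : Module.End k (V ⊗[k] V)) : op12 (c * d) = op12 c * op12 d :=
  LinearMap.rTensor_mul V c d

lemma op23_mul (c d : Module.End k (V ⊗[k] V)) : op23 (c * d) = op23 c * op23 d := by
  ext x y z
  simp [op23]

lemma op12_one : op12 (1 : Module.End k (V ⊗[k] V)) = 1 := LinearMap.rTensor_id _ _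

lemma op23_one : op23 (1 : Module.End k (V ⊗[k] V)) = 1 := by
  ext x y z
  simp [op23]

/-- Both sides of the braid equation are palindromes, so inverting them yields the same equation for
the inverse operators. -/
lemma IsBraided.of_inverse {c d : Module.End k (V ⊗[k] V)} (h : IsBraided c) (hcd : c * d = 1)
    (hdc : d * c = 1) : IsBraided d := by
  refine ⟨⟨⟨d, c, hdc, hcd⟩, rfl⟩, ?_⟩
  have a : op12 c * op12 d = 1 := by rw [← op12_mul, hcd, op12_one]
  have a' : op12 d * op12 c = 1 := by rw [← op12_mul, hdc, op12_one]
  have b : op23 c * op23 d = 1 := by rw [← op23_mul, hcd, op23_one]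
  have b' : op23 d * op23 c = 1 := by rw [← op23_mul, hdc, op23_one]
  have hb := h.braid
  let u : (Module.End k ((V ⊗[k] V) ⊗[k] V))ˣ := ⟨_, _, a, a'⟩
  let v : (Module.End k ((V ⊗[k] V) ⊗[k] V))ˣ := ⟨_, _, b, b'⟩
  have huv : u * v * u = v * u * v := Units.ext hb
  have := congrArg (fun w : (Module.End k ((V ⊗[k] V) ⊗[k] V))ˣ => w⁻¹.val) huv
  simpa [mul_assoc, u, v] using this

/-- Lower indices are inputs, so contracting the coefficients of `c` with those of `d` computes `d ∘
c`; hence the order in `h`. -/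
lemma coeffInverse_braidCoeff [DecidableEq ι] (b : Module.Basis ι k V)
    {c d : Module.End k (V ⊗[k] V)} (h : d * c = 1) :
    FRTAlgebra.CoeffInverse (braidCoeff b c) (braidCoeff b d) := by
  intro i j p q
  have : d (c (b i ⊗ₜ b j)) = b i ⊗ₜ b j := LinearMap.congr_fun h (b i ⊗ₜ b j)
  rw [apply_eq_sum_braidCoeff b c] at this
  simp only [map_sum, map_smul] at this
  have := congrArg (fun z => (b.tensorProduct b).repr z (p, q)) this
  simp only [map_sum, map_smul, Finsupp.finsetSum_apply, Finsupp.smul_apply, smul_eq_mul] at this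
  refine this.trans ?_
  simp [Finsupp.single_apply, ite_and]

end Braided

end

/-! ### Assembly of the main theorem. -/

theorem mainTheorem10 {k V ι : Type*} [Field k] [AddCommGroup V] [Module k V]
    [Fintype ι] [DecidableEq ι] (b : Module.Basis ι k V)
    (c : Module.End k (V ⊗[k] V)) (hc : IsBraided c) :
    (∀ i p j q, FRT.rForm b hc (FRT.T b c i p ⊗ₜ[k] FRT.T b c j q) = braidCoeff b c j i p q) ∧
    Cartier.IsUniversalRForm (FRT.rForm b hc) ∧
    (∀ w : List (ι × ι), FRT.degDeriv b c (FRT.monomial b c w) =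
      (w.length : k) * FRT.counit b c (FRT.monomial b c w)) ∧
    (∀ x y : FRT b c, FRT.degDeriv b c (x * y) =
      FRT.degDeriv b c x * FRT.counit b c y + FRT.counit b c x * FRT.degDeriv b c y) ∧
    ∀ t : k, ∃ χ : FRT b c ⊗[k] FRT b c →ₗ[k] k,
      (∀ w w' : List (ι × ι), χ (FRT.monomial b c w ⊗ₜ[k] FRT.monomial b c w') =
        t * (w.length : k) * (w'.length : k) *
          FRT.counit b c (FRT.monomial b c w * FRT.monomial b c w')) ∧
      χ = t • (LinearMap.mul' k k ∘ₗ TensorProduct.map (FRT.degDeriv b c) (FRT.degDeriv b c)) ∧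
      Cartier.IsInfinitesimalRForm (FRT.rForm b hc) χ ∧
      Cartier.IsCartier (FRT.rForm b hc) χ := by
  obtain ⟨u, hu⟩ := hc.isUnit
  have hcd : c * (↑u⁻¹ : Module.End k (V ⊗[k] V)) = 1 := by rw [← hu]; exact u.mul_inv
  have hdc : (↑u⁻¹ : Module.End k (V ⊗[k] V)) * c = 1 := by rw [← hu]; exact u.inv_mul
  have hR : Cartier.IsUniversalRForm (FRT.rForm b hc) :=
    -- The braid equation for `c⁻¹` is needed because the inverse of `R` is built from the
    -- bicharacter of `A(c⁻¹)`.
    FRTAlgebra.isUniversalRForm_rForm _ ((hc.of_inverse hcd hdc).coeffBraid b)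
      (coeffInverse_braidCoeff b hdc) (coeffInverse_braidCoeff b hcd)
  have hχ := hR.isCartier_smul_map FRTAlgebra.degDeriv_mul FRTAlgebra.isCocentral_degDeriv
  refine ⟨FRTAlgebra.rForm_T_tmul_T _, hR, FRTAlgebra.degDeriv_monomial,
    FRTAlgebra.degDeriv_mul, fun t => ⟨_, fun w w' => ?_, rfl, (hχ t).1, hχ t⟩⟩
  simp only [LinearMap.smul_apply, LinearMap.comp_apply, TensorProduct.map_tmul,
    LinearMap.mul'_apply, smul_eq_mul, FRTAlgebra.degDeriv_monomial, FRT.counit,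
    Bialgebra.counit_mul]
  ring
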